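/- For a field $\mathbb F$, a matrix $A\in\mathbb F^{n\times n}$ and a real $0\le r\le n$, let $R_{\mathbb F}(A,r)$ be the minimum number of non-zero entries of a matrix $Z\in\mathbb F^{n\times n}$ with $\operatorname{rank}(A-Z)\le r$, and let $R^{rc}_{\mathbb F}(A,r)$ be the minimal $t$ for which there is $Z\in\mathbb F^{n\times n}$ with $\operatorname{rank}(A-Z)\le r$ such that every row and every column of $Z$ has at most $t$ non-zero entries. There is an absolute constant $c>0$ such that for every integer $d\ge 2$ and every real $0<\varepsilon<1$ there exists $$\gamma\ \ge\ c\cdot\frac{\varepsilon^2}{d^{3/2}\,\log d\,\log^2(d/\varepsilon)}$$ with the following property. Let $\mathbb F$ be any field and let $M_1,\dots,M_k$ be any finite sequence of matrices with $M_i\in\mathbb F^{d_i\times d_i}$ and $2\le d_i\le d$. Put $M=\bigotimes_{i=1}^k M_i$ and $n=\prod_{i=1}^k d_i$. If $n\ge d^{1/\gamma}$, then $$R^{rc}_{\mathbb F}(M,n^{1-\gamma})\le n^{\varepsilon}\qquad\text{and}\qquad R_{\mathbb F}(M,n^{1-\gamma})\le n^{1+\varepsilon}.$$ -/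

import Mathlib

noncomputable section

namespace KroneckerRigidity

/-- The Kronecker product of a finite sequence of square matrices `M i` of sizes `s i`, with rows and
columns indexed by tuples: the entry at `(x, y)` is the product of the entries `M i (x i) (y i)`. -/
def kroneckerProd {F : Type*} [Field F] {k : ℕ} {s : Fin k → ℕ}
    (M : ∀ i, Matrix (Fin (s i)) (Fin (s i)) F) :
    Matrix (∀ i, Fin (s i)) (∀ i, Fin (s i)) F :=
  Matrix.of fun x y => ∏ i, M i (x i) (y i)

/-- The rigidity of `A` for the (real) target rank `r`: the minimum number of non-zero entries of a
matrix `Z` with `rank (A - Z) ≤ r`. For `r ≥ 0` the set is non-empty, since `Z = A` is allowed. -/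
def rigidity {F ι : Type*} [Field F] [Fintype ι] (A : Matrix ι ι F) (r : ℝ) : ℕ :=
  sInf {t : ℕ | ∃ Z : Matrix ι ι F, ((A - Z).rank : ℝ) ≤ r ∧
    {p : ι × ι | Z p.1 p.2 ≠ 0}.ncard = t}

/-- The row-column rigidity of `A` for the (real) target rank `r`: the minimum `t` for which some
matrix `Z` with `rank (A - Z) ≤ r` has at most `t` non-zero entries in every row and every column.
For `r ≥ 0` the set is non-empty, since `Z = A` is allowed. -/
def rcRigidity {F ι : Type*} [Field F] [Fintype ι] (A : Matrix ι ι F) (r : ℝ) : ℕ :=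
  sInf {t : ℕ | ∃ Z : Matrix ι ι F, ((A - Z).rank : ℝ) ≤ r ∧
    (∀ x, {y | Z x y ≠ 0}.ncard ≤ t) ∧ (∀ y, {x | Z x y ≠ 0}.ncard ≤ t)}

end KroneckerRigidity

end

/-! Each `m × m` factor is a generalized permutation times `m` "arrow" matrices, supported on the
diagonal and one column (`exists_mul_prod_arrow`). Padding with identities to `d` arrows and using
that Kronecker products respect multiplication, `M` becomes a sparse matrix times `d` Kronecker
products of arrows. Writing a matrix as low rank plus sparse is stable under products: ranks add and
sparsities multiply (`IsLowRankAddSparse.mul`).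

For one product of arrows, a non-zero entry at `(x, y)` forces `y i = a i` wherever `x i ≠ y i`. So
the Hamming distance, with weights `log (s i)`, is the increase from `x` to `y` in the weighted
number of agreements with `a`. By a Chernoff bound few rows fall far below the mean and few columns
rise far above it. Once these are deleted, every remaining entry lies in a small Hamming ball
(`isLowRankAddSparse_kroneckerProd_arrow`).

The `j`-th product involves only coordinates with `s i > j`, where agreement has probability at most
`1 / (j + 1)`. Its radius can therefore shrink like `1 / √(j + 1)` at the same cost in rank. Summing
over `j < d` yields a bound with `d` in place of `d ^ (3 / 2)`. -/

noncomputable section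
namespace KroneckerRigidity

/-! ### Factorization into arrow matrices -/

/-- A matrix whose columns outside `J` are distinct standard basis vectors is the product of a
matrix supported on the graph of an injection and `J.card` matrices, each supported on the diagonal
and one column. -/
theorem exists_mul_prod_of_cols_eq_single {F : Type*} [Field F] {m : ℕ} (N : ℕ) :
    ∀ (J : Finset (Fin m)), J.card = N → ∀ (M : Matrix (Fin m) (Fin m) F) (p : Fin m → Fin m),
      Set.InjOn p {b | b ∉ J} → (∀ b ∉ J, M.transpose b = Pi.single (p b) 1) →
      ∃ (P : Matrix (Fin m) (Fin m) F) (p : Fin m → Fin m) (C : ℕ → Matrix (Fin m) (Fin m) F),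
        Function.Injective p ∧ (∀ x y, P x y ≠ 0 → x = p y) ∧
        (∀ j < N, ∃ a, ∀ x y, C j x y ≠ 0 → x = y ∨ y = a) ∧ (∀ j, N ≤ j → C j = 1) ∧
        M = P * ((List.range N).map C).prod := by
  classical
  induction N with
  | zero =>
    intro J hJ M p hp hM
    obtain rfl := Finset.card_eq_zero.1 hJ
    refine ⟨M, p, fun _ => 1, fun a b h => hp (by simp) (by simp) h, fun x y h => ?_, by simp,
      by simp, by simp⟩
    by_contra hxy
    have := congrFun (hM y (by simp)) x
    rw [Pi.single_eq_of_ne hxy] at this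
    exact h this
  | succ N ih =>
    intro J hJ M p hp hM
    set v : Fin m → Fin m → F := M.transpose with hv
    -- The column to replace must come from `J`. Columns outside `J` are distinct basis vectors, so
    -- a linear dependence cannot be supported on them alone.
    have key : ∃ a ∈ J, v a ∈ Submodule.span F (v '' {b | b ≠ a}) ∨ LinearIndependent F v := by
      by_cases h : LinearIndependent F v
      · obtain ⟨a, ha⟩ : J.Nonempty := Finset.card_pos.1 (by omega)
        exact ⟨a, ha, Or.inr h⟩
      · obtain ⟨g, hg, i, hi⟩ := Fintype.not_linearIndependent_iff.1 h
        obtain ⟨a, ha, hga⟩ : ∃ a ∈ J, g a ≠ 0 := by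
          by_contra! hJ0
          have hiJ : i ∉ J := fun h => hi (hJ0 i h)
          have h1 := congrFun hg (p i)
          rw [Finset.sum_apply, Finset.sum_eq_single i] at h1
          · rw [Pi.smul_apply, hM i hiJ] at h1
            simp at h1
            exact hi h1
          · intro b _ hb
            by_cases hbJ : b ∈ J
            · simp [hJ0 b hbJ]
            · rw [Pi.smul_apply, hM b hbJ, Pi.single_eq_of_ne, smul_zero]
              exact fun h => hb (hp hbJ hiJ h.symm)
          · simp
        refine ⟨a, ha, Or.inl ?_⟩
        rw [← Finset.add_sum_erase _ _ (Finset.mem_univ a)] at hg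
        have h2 : v a = (-(g a)⁻¹) • ∑ b ∈ Finset.univ.erase a, g b • v b := by
          rw [eq_neg_of_add_eq_zero_right hg, neg_smul_neg, smul_smul, inv_mul_cancel₀ hga,
            one_smul]
        rw [h2]
        refine Submodule.smul_mem _ _ (Submodule.sum_mem _ fun b hb => Submodule.smul_mem _ _ ?_)
        exact Submodule.subset_span ⟨b, (Finset.mem_erase.1 hb).1, rfl⟩
    obtain ⟨a, haJ, hkey⟩ := key
    set W := Submodule.span F (v '' {b | b ≠ a}) with hW
    -- `W` is spanned by at most `m - 1` vectors, so it misses a basis vector. Replacing column `a`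
    -- by that vector keeps the old column in the span of the new ones, and makes `M` equal `M'`
    -- times an arrow.
    obtain ⟨q, hq⟩ : ∃ q, (Pi.single q 1 : Fin m → F) ∉ W := by
      by_contra! hall
      have htop : W = ⊤ := by
        rw [eq_top_iff, ← (Pi.basisFun F (Fin m)).span_eq, Submodule.span_le]
        rintro _ ⟨q, rfl⟩
        simpa using hall q
      have h1 : W = Submodule.span F ((Finset.univ.erase a).image v : Set (Fin m → F)) := by
        rw [hW]; congr 1; ext; simp
      have h2 := finrank_span_finset_le_card (R := F) ((Finset.univ.erase a).image v)
      rw [Set.finrank, ← h1, htop, finrank_top, Module.finrank_fin_fun] at h2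
      have h3 := (Finset.univ.erase a).card_image_le (f := v)
      rw [Finset.card_erase_of_mem (Finset.mem_univ a), Finset.card_univ, Fintype.card_fin] at h3
      have := a.pos
      omega
    set M' := M.updateCol a (Pi.single q 1) with hM'
    have hM'a : M'.transpose a = Pi.single q 1 := by ext x; simp [hM']
    have hM'b : ∀ b, b ≠ a → M'.transpose b = v b := by
      intro b hb; ext x; simp [hM', hb, hv]
    have hWS : W ≤ Submodule.span F (Set.range M'.transpose) := by
      rw [hW, Submodule.span_le]
      rintro _ ⟨b, hb, rfl⟩
      exact Submodule.subset_span ⟨b, hM'b b hb⟩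
    have hmem : v a ∈ Submodule.span F (Set.range M'.transpose) := by
      rcases hkey with h | h
      · exact hWS h
      · have htop := h.span_eq_top_of_card_eq_finrank' (by simp)
        have h1 : (Pi.single q 1 : Fin m → F) ∈
            Submodule.span F (insert (v a) (v '' {b | b ≠ a})) := by
          have : Set.range v ⊆ insert (v a) (v '' {b | b ≠ a}) := by
            rintro _ ⟨b, rfl⟩
            by_cases hb : b = a
            · exact Or.inl (by rw [hb])
            · exact Or.inr ⟨b, hb, rfl⟩
          exact Submodule.span_mono this (by rw [htop]; trivial)
        obtain ⟨c, z, hz, hc⟩ := Submodule.mem_span_insert.1 h1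
        have hc0 : c ≠ 0 := by
          rintro rfl
          rw [zero_smul, zero_add] at hc
          exact hq (hc ▸ hz)
        have h2 : v a = c⁻¹ • ((Pi.single q 1 : Fin m → F) - z) := by
          rw [hc, add_sub_cancel_right, smul_smul, inv_mul_cancel₀ hc0, one_smul]
        rw [h2]
        exact Submodule.smul_mem _ _
          (Submodule.sub_mem _ (Submodule.subset_span ⟨a, hM'a⟩) (hWS hz))
    obtain ⟨u, hu⟩ := (Submodule.mem_span_range_iff_exists_fun F).1 hmem
    have hMM' : M = M' * (1 : Matrix (Fin m) (Fin m) F).updateCol a u := by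
      ext x y
      rw [Matrix.mul_apply]
      by_cases hy : y = a
      · subst hy
        have := congrFun hu x
        rw [Finset.sum_apply] at this
        simp only [hv, Pi.smul_apply, Matrix.transpose_apply, smul_eq_mul] at this
        rw [← this]
        exact Finset.sum_congr rfl fun b _ => by simp [mul_comm]
      · rw [Finset.sum_eq_single y]
        · simp [hM', hy]
        · intro b _ hb; simp [hy, hb]
        · simp
    -- The new basis vector is fresh because those already present lie in `W`; this preserves
    -- injectivity of `p`.
    have hqp : ∀ b ∉ J, p b ≠ q := by
      intro b hb hbq
      apply hq
      rw [← hbq, ← hM b hb]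
      exact Submodule.subset_span ⟨b, fun h => hb (h ▸ haJ), rfl⟩
    have hnot : ∀ b, b ∉ J.erase a → b ≠ a → b ∉ J := fun b hb hba h =>
      hb (Finset.mem_erase.2 ⟨hba, h⟩)
    obtain ⟨P, p', C, hp', hP, hC, hC1, hprod⟩ := ih (J.erase a)
      (by rw [Finset.card_erase_of_mem haJ, hJ]; rfl) M' (Function.update p a q)
      (by
        intro b hb c hc hbc
        by_cases hba : b = a <;> by_cases hca : c = a
        · rw [hba, hca]
        · subst hba
          simp only [Function.update_self, Function.update_of_ne hca] at hbc
          exact absurd hbc.symm (hqp c (hnot c hc hca))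
        · subst hca
          simp only [Function.update_self, Function.update_of_ne hba] at hbc
          exact absurd hbc (hqp b (hnot b hb hba))
        · simp only [Function.update_of_ne hba, Function.update_of_ne hca] at hbc
          exact hp (hnot b hb hba) (hnot c hc hca) hbc)
      (by
        intro b hb
        by_cases hba : b = a
        · subst hba; rw [hM'a, Function.update_self]
        · rw [hM'b b hba, Function.update_of_ne hba, hM b (hnot b hb hba)])
    refine ⟨P, p', Function.update C N ((1 : Matrix (Fin m) (Fin m) F).updateCol a u), hp', hP,
      fun j hj => ?_, fun j hj => ?_, ?_⟩
    · by_cases hjN : j = N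
      · subst hjN
        refine ⟨a, fun x y h => ?_⟩
        by_contra! hxy
        simp [hxy.1, hxy.2] at h
      · rw [Function.update_of_ne hjN]
        exact hC j (by omega)
    · rw [Function.update_of_ne (by omega)]
      exact hC1 j (by omega)
    · rw [List.range_succ, List.map_append, List.prod_append, List.map_singleton,
        List.prod_singleton, Function.update_self, ← mul_assoc]
      have : (List.range N).map (Function.update C N
          ((1 : Matrix (Fin m) (Fin m) F).updateCol a u)) = (List.range N).map C :=
        List.map_congr_left fun j hj => Function.update_of_ne (List.mem_range.1 hj).ne _ _
      rw [this, ← hprod, ← hMM']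

/-- Every `m × m` matrix is the product of a matrix supported on the graph of an injection and
`m` matrices, each supported on the diagonal and one column, padded with identity matrices. -/
theorem exists_mul_prod_arrow {F : Type*} [Field F] {m d : ℕ} (hm : 0 < m) (hmd : m ≤ d)
    (M : Matrix (Fin m) (Fin m) F) :
    ∃ (P : Matrix (Fin m) (Fin m) F) (p : Fin m → Fin m) (C : ℕ → Matrix (Fin m) (Fin m) F)
      (a : ℕ → Fin m), Function.Injective p ∧ (∀ x y, P x y ≠ 0 → x = p y) ∧
        (∀ j x y, C j x y ≠ 0 → x = y ∨ (j < m ∧ y = a j)) ∧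
        M = P * ((List.range d).map C).prod := by
  obtain ⟨P, p, C, hp, hP, hC, hC1, hM⟩ := exists_mul_prod_of_cols_eq_single m Finset.univ
    (by simp) M id (fun b hb => absurd (Finset.mem_univ b) hb)
    (fun b hb => absurd (Finset.mem_univ b) hb)
  have hC' : ∀ j, ∃ a : Fin m, ∀ x y, C j x y ≠ 0 → x = y ∨ (j < m ∧ y = a) := by
    intro j
    by_cases hj : j < m
    · obtain ⟨a, ha⟩ := hC j hj
      exact ⟨a, fun x y h => (ha x y h).imp_right fun h => ⟨hj, h⟩⟩
    -- For `j ≥ m` the factor is the identity, and the column index is a dummy.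
    · refine ⟨⟨0, hm⟩, fun x y h => Or.inl ?_⟩
      rw [hC1 j (not_lt.1 hj)] at h
      by_contra hxy
      exact h (Matrix.one_apply_ne hxy)
  choose a ha using hC'
  refine ⟨P, p, C, a, hp, hP, ha, ?_⟩
  obtain ⟨e, rfl⟩ := Nat.exists_eq_add_of_le hmd
  rw [List.range_add, List.map_append, List.prod_append, ← mul_assoc, ← hM]
  have : ((List.map (fun x => m + x) (List.range e)).map C).prod = 1 := by
    apply List.prod_eq_one
    intro A hA
    simp only [List.map_map, List.mem_map, Function.comp_apply] at hA
    obtain ⟨j, -, rfl⟩ := hA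
    exact hC1 _ (by omega)
  rw [this, mul_one]

/-! ### Low rank plus sparse decompositions -/

/-- `A` is the sum of a matrix of rank at most `r` and a matrix with at most `t` non-zero entries in
every row and every column. -/
def IsLowRankAddSparse {F ι : Type*} [Field F] [Fintype ι] (A : Matrix ι ι F) (r t : ℝ) : Prop :=
  ∃ Z : Matrix ι ι F, ((A - Z).rank : ℝ) ≤ r ∧
    (∀ x, ({y | Z x y ≠ 0}.ncard : ℝ) ≤ t) ∧ (∀ y, ({x | Z x y ≠ 0}.ncard : ℝ) ≤ t)

section LowRankAddSparse

variable {F ι : Type*} [Field F] [Fintype ι] {A B : Matrix ι ι F} {r t r' t' : ℝ}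

theorem rank_add_le (A B : Matrix ι ι F) : (A + B).rank ≤ A.rank + B.rank := by
  rw [Matrix.rank, Matrix.mulVecLin_add]
  have h : LinearMap.range (A.mulVecLin + B.mulVecLin) ≤
      LinearMap.range A.mulVecLin ⊔ LinearMap.range B.mulVecLin := by
    rintro _ ⟨x, rfl⟩
    exact Submodule.add_mem_sup ⟨x, rfl⟩ ⟨x, rfl⟩
  exact (Submodule.finrank_mono h).trans (Submodule.finrank_add_le_finrank_add_finrank _ _)

theorem ncard_row_mul_le (Z Y : Matrix ι ι F) (ht : ∀ x, ({y | Z x y ≠ 0}.ncard : ℝ) ≤ t)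
    (ht' : ∀ x, ({y | Y x y ≠ 0}.ncard : ℝ) ≤ t') (x : ι) :
    ({y | (Z * Y) x y ≠ 0}.ncard : ℝ) ≤ t * t' := by
  classical
  have ht0 : 0 ≤ t' := (Nat.cast_nonneg _).trans (ht' x)
  have hsub : {y | (Z * Y) x y ≠ 0} ⊆
      ↑((Finset.univ.filter fun z => Z x z ≠ 0).biUnion
        fun z => Finset.univ.filter fun y => Y z y ≠ 0) := by
    intro y hy
    rw [Set.mem_ofPred_eq, Matrix.mul_apply] at hy
    obtain ⟨z, -, hz⟩ := Finset.exists_ne_zero_of_sum_ne_zero hy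
    simp only [Finset.coe_biUnion, Finset.coe_filter, Finset.mem_univ, true_and, Set.mem_ofPred_eq,
      Set.mem_iUnion]
    exact ⟨z, left_ne_zero_of_mul hz, right_ne_zero_of_mul hz⟩
  have hcard : ∀ (X : Matrix ι ι F) z, ((Finset.univ.filter fun y => X z y ≠ 0).card : ℝ) =
      ({y | X z y ≠ 0}.ncard : ℝ) := by
    intro X z
    rw [← Set.ncard_coe_finset]; simp
  calc ({y | (Z * Y) x y ≠ 0}.ncard : ℝ)
      ≤ (((Finset.univ.filter fun z => Z x z ≠ 0).biUnion
        fun z => Finset.univ.filter fun y => Y z y ≠ 0).card : ℝ) := by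
        rw [← Set.ncard_coe_finset]
        exact_mod_cast Set.ncard_le_ncard hsub (Set.toFinite _)
    _ ≤ ∑ z ∈ Finset.univ.filter fun z => Z x z ≠ 0,
          ((Finset.univ.filter fun y => Y z y ≠ 0).card : ℝ) := by
        exact_mod_cast Finset.card_biUnion_le
    _ ≤ ∑ z ∈ Finset.univ.filter fun z => Z x z ≠ 0, t' :=
        Finset.sum_le_sum fun z _ => (hcard Y z).trans_le (ht' z)
    _ = ({y | Z x y ≠ 0}.ncard : ℝ) * t' := by rw [Finset.sum_const, nsmul_eq_mul, hcard]
    _ ≤ t * t' := mul_le_mul_of_nonneg_right (ht x) ht0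

theorem IsLowRankAddSparse.mul (hA : IsLowRankAddSparse A r t) (hB : IsLowRankAddSparse B r' t') :
    IsLowRankAddSparse (A * B) (r + r') (t * t') := by
  classical
  obtain ⟨Z, hZ, hZr, hZc⟩ := hA
  obtain ⟨Y, hY, hYr, hYc⟩ := hB
  refine ⟨Z * Y, ?_, ncard_row_mul_le Z Y hZr hYr, fun y => ?_⟩
  -- Each of the two terms has a low-rank factor.
  · have h : A * B - Z * Y = (A - Z) * B + Z * (B - Y) := by noncomm_ring
    rw [h]
    have h1 := rank_add_le ((A - Z) * B) (Z * (B - Y))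
    have h2 := Matrix.rank_mul_le_left (A - Z) B
    have h3 := Matrix.rank_mul_le_right Z (B - Y)
    have h4 : (((A - Z) * B + Z * (B - Y)).rank : ℝ) ≤ (A - Z).rank + (B - Y).rank := by
      exact_mod_cast h1.trans (add_le_add h2 h3)
    linarith
  · have := ncard_row_mul_le Y.transpose Z.transpose (t := t') (t' := t) hYc hZc y
    rw [← Matrix.transpose_mul, mul_comm] at this
    exact this

theorem IsLowRankAddSparse.mono (hA : IsLowRankAddSparse A r t) (hr : r ≤ r') (ht : t ≤ t') :
    IsLowRankAddSparse A r' t' := by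
  obtain ⟨Z, h, h1, h2⟩ := hA
  exact ⟨Z, h.trans hr, fun x => (h1 x).trans ht, fun x => (h2 x).trans ht⟩

theorem IsLowRankAddSparse.mul_prod_range (hA : IsLowRankAddSparse A r t) (C : ℕ → Matrix ι ι F)
    [DecidableEq ι] (ρ τ : ℕ → ℝ) (N : ℕ) (hC : ∀ j < N, IsLowRankAddSparse (C j) (ρ j) (τ j)) :
    IsLowRankAddSparse (A * ((List.range N).map C).prod) (r + ∑ j ∈ Finset.range N, ρ j)
      (t * ∏ j ∈ Finset.range N, τ j) := by
  induction N with
  | zero => simpa using hA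
  | succ N ih =>
    rw [List.range_succ, List.map_append, List.prod_append, List.map_singleton,
      List.prod_singleton, ← mul_assoc, Finset.sum_range_succ, Finset.prod_range_succ,
      ← add_assoc, ← mul_assoc]
    exact (ih fun j hj => hC j (by omega)).mul (hC N (by omega))

/-- A matrix supported on the graph of an injection is sparse. -/
theorem isLowRankAddSparse_of_injective {p : ι → ι} (hp : Function.Injective p)
    (hA : ∀ x y, A x y ≠ 0 → x = p y) : IsLowRankAddSparse A 0 1 := by
  refine ⟨A, by simp, fun x => ?_, fun y => ?_⟩
  · have : {y | A x y ≠ 0}.ncard ≤ 1 := (Set.ncard_le_one (Set.toFinite _)).2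
      fun y hy z hz => hp ((hA x y hy).symm.trans (hA x z hz))
    exact_mod_cast this
  · have : {x | A x y ≠ 0}.ncard ≤ 1 := (Set.ncard_le_one (Set.toFinite _)).2
      fun x hx z hz => (hA x y hx).trans (hA z y hz).symm
    exact_mod_cast this

theorem rank_le_card_of_rows [DecidableEq ι] (B : Matrix ι ι F) (R : Finset ι)
    (hB : ∀ x y, B x y ≠ 0 → x ∈ R) : B.rank ≤ R.card := by
  classical
  have h : B = Matrix.diagonal (fun x => if x ∈ R then (1 : F) else 0) * B := by
    ext x y
    rw [Matrix.diagonal_mul]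
    by_cases hx : x ∈ R
    · simp [hx]
    · simp [hx, not_not.1 fun h => hx (hB x y h)]
  rw [h]
  refine (Matrix.rank_mul_le_left _ _).trans ?_
  rw [Matrix.rank_diagonal]
  simp

/-- Deleting few rows and columns changes the rank by little. -/
theorem isLowRankAddSparse_of_delete [DecidableEq ι] (R C : Finset ι)
    (hR : ∀ x, ({y | x ∉ R ∧ y ∉ C ∧ A x y ≠ 0}.ncard : ℝ) ≤ t)
    (hC : ∀ y, ({x | x ∉ R ∧ y ∉ C ∧ A x y ≠ 0}.ncard : ℝ) ≤ t) :
    IsLowRankAddSparse A (R.card + C.card) t := by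
  have hZ : ∀ x y, (if x ∈ R ∨ y ∈ C then 0 else A x y) ≠ 0 ↔ x ∉ R ∧ y ∉ C ∧ A x y ≠ 0 := by
    intro x y; split_ifs with h <;> tauto
  refine ⟨Matrix.of fun x y => if x ∈ R ∨ y ∈ C then 0 else A x y, ?_, ?_, ?_⟩
  · set B₁ : Matrix ι ι F := Matrix.of fun x y => if x ∈ R then A x y else 0 with hB₁
    set B₂ : Matrix ι ι F := Matrix.of fun x y => if x ∉ R ∧ y ∈ C then A x y else 0 with hB₂
    have hs : A - Matrix.of (fun x y => if x ∈ R ∨ y ∈ C then 0 else A x y) = B₁ + B₂ := by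
      ext x y
      by_cases hx : x ∈ R <;> by_cases hy : y ∈ C <;> simp [B₁, B₂, hx, hy]
    have h1 : B₁.rank ≤ R.card := rank_le_card_of_rows B₁ R fun x y h => by
      by_contra hx; simp [B₁, hx] at h
    have h2 : B₂.rank ≤ C.card := by
      rw [← Matrix.rank_transpose]
      exact rank_le_card_of_rows _ C fun x y h => by
        by_contra hx; simp [B₂, hx] at h
    rw [hs]
    exact_mod_cast (rank_add_le _ _).trans (add_le_add h1 h2)
  · intro x
    simpa only [Matrix.of_apply, hZ] using hR x
  · intro y
    simpa only [Matrix.of_apply, hZ] using hC y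

theorem IsLowRankAddSparse.rcRigidity_le (hA : IsLowRankAddSparse A r t) (ht : 0 ≤ t) :
    (rcRigidity A r : ℝ) ≤ t := by
  obtain ⟨Z, h, h1, h2⟩ := hA
  have : rcRigidity A r ≤ ⌊t⌋₊ :=
    Nat.sInf_le ⟨Z, h, fun x => Nat.le_floor (h1 x), fun y => Nat.le_floor (h2 y)⟩
  exact (Nat.cast_le.2 this).trans (Nat.floor_le ht)

theorem IsLowRankAddSparse.rigidity_le (hA : IsLowRankAddSparse A r t) :
    (rigidity A r : ℝ) ≤ Fintype.card ι * t := by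
  classical
  obtain ⟨Z, h, h1, -⟩ := hA
  have h0 : rigidity A r ≤ {p : ι × ι | Z p.1 p.2 ≠ 0}.ncard := Nat.sInf_le ⟨Z, h, rfl⟩
  have h2 : {p : ι × ι | Z p.1 p.2 ≠ 0}.ncard = ∑ x, {y | Z x y ≠ 0}.ncard := by
    have e1 : {p : ι × ι | Z p.1 p.2 ≠ 0} =
        ↑(Finset.univ.sigma (fun x => Finset.univ.filter fun y => Z x y ≠ 0) |>.map
          (Equiv.sigmaEquivProd ι ι).toEmbedding) := by
      ext ⟨x, y⟩
      simp
    rw [e1, Set.ncard_coe_finset, Finset.card_map, Finset.card_sigma]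
    refine Finset.sum_congr rfl fun x _ => ?_
    rw [← Set.ncard_coe_finset]; simp
  calc (rigidity A r : ℝ) ≤ ∑ x, ({y | Z x y ≠ 0}.ncard : ℝ) := by
        rw [h2] at h0; exact_mod_cast h0
    _ ≤ ∑ _x : ι, t := Finset.sum_le_sum fun x _ => h1 x
    _ = Fintype.card ι * t := by simp

end LowRankAddSparse

/-! ### Multiplicativity of the Kronecker product -/

theorem kroneckerProd_mul {F : Type*} [Field F] {k : ℕ} {s : Fin k → ℕ}
    (A B : ∀ i, Matrix (Fin (s i)) (Fin (s i)) F) :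
    kroneckerProd (fun i => A i * B i) = kroneckerProd A * kroneckerProd B := by
  ext x y
  simp only [kroneckerProd, Matrix.of_apply, Matrix.mul_apply, ← Finset.prod_mul_distrib]
  rw [Finset.prod_univ_sum, Fintype.piFinset_univ]

theorem kroneckerProd_one {F : Type*} [Field F] {k : ℕ} {s : Fin k → ℕ} :
    kroneckerProd (fun i => (1 : Matrix (Fin (s i)) (Fin (s i)) F)) = 1 := by
  ext x y
  rw [kroneckerProd, Matrix.of_apply]
  by_cases h : x = y
  · subst h
    rw [Matrix.one_apply_eq]
    exact Finset.prod_eq_one fun i _ => Matrix.one_apply_eq _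
  · obtain ⟨i, hi⟩ := Function.ne_iff.1 h
    rw [Matrix.one_apply_ne h]
    exact Finset.prod_eq_zero (Finset.mem_univ i) (Matrix.one_apply_ne hi)

theorem kroneckerProd_prod_range {F : Type*} [Field F] {k : ℕ} {s : Fin k → ℕ}
    (C : ∀ i, ℕ → Matrix (Fin (s i)) (Fin (s i)) F) (N : ℕ) :
    kroneckerProd (fun i => ((List.range N).map (C i)).prod) =
      ((List.range N).map fun j => kroneckerProd fun i => C i j).prod := by
  induction N with
  | zero => simpa using kroneckerProd_one
  | succ N ih =>
    have h : (fun i => ((List.range (N + 1)).map (C i)).prod) =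
        fun i => ((List.range N).map (C i)).prod * C i N := by
      funext i
      rw [List.range_succ, List.map_append, List.prod_append, List.map_singleton,
        List.prod_singleton]
    rw [h, kroneckerProd_mul, ih, List.range_succ, List.map_append, List.prod_append,
      List.map_singleton, List.prod_singleton]

/-! ### Chernoff bounds by counting -/

section Counting

variable {k : ℕ} {s : Fin k → ℕ}

/-- The exponential Markov inequality for sums of independent variables, in counting form. -/
theorem card_filter_le_exp_mul_prod (f : ∀ i, Fin (s i) → ℝ) (T : ℝ) :
    ((Finset.univ.filter fun z : ∀ i, Fin (s i) => T ≤ ∑ i, f i (z i)).card : ℝ) ≤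
      Real.exp (-T) * ∏ i, ∑ a, Real.exp (f i a) := by
  rw [Finset.prod_univ_sum, Fintype.piFinset_univ, Finset.mul_sum, Finset.card_eq_sum_ones,
    Nat.cast_sum]
  refine (Finset.sum_le_sum (g := fun z => Real.exp (-T) * ∏ i, Real.exp (f i (z i)))
    fun z hz => ?_).trans (Finset.sum_le_sum_of_subset_of_nonneg (Finset.filter_subset _ _)
      fun z _ _ => by positivity)
  rw [← Real.exp_sum, ← Real.exp_add, Nat.cast_one, Real.one_le_exp_iff]
  linarith [(Finset.mem_filter.1 hz).2]

theorem log_prod_natCast (hs : ∀ i, 2 ≤ s i) :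
    Real.log ((∏ i, s i : ℕ) : ℝ) = ∑ i, Real.log (s i) := by
  rw [Nat.cast_prod, Real.log_prod]
  intro i _
  have := hs i
  positivity

/-- As `2 * log m ≥ 1`, the left side is at most `δ / 2`, which is at most `δ * log m`. It bounds
the contribution of the `m` possible values at one coordinate of a Hamming ball. -/
theorem exp_neg_mul_log_le {m : ℕ} (hm : 2 ≤ m) {δ : ℝ} (hδ : 0 < δ) (hδ1 : δ ≤ 1) :
    Real.exp (-(2 * Real.log (2 / δ)) * Real.log m) ≤ δ * Real.log m := by
  have h2 : (1 : ℝ) / 2 ≤ Real.log 2 := by linarith [Real.log_two_gt_d9]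
  have hm' : Real.log 2 ≤ Real.log m := Real.log_le_log (by norm_num) (by exact_mod_cast hm)
  have hL : 0 ≤ Real.log (2 / δ) := Real.log_nonneg (by rw [le_div_iff₀ hδ]; linarith)
  calc Real.exp (-(2 * Real.log (2 / δ)) * Real.log m)
      ≤ Real.exp (-Real.log (2 / δ)) := Real.exp_le_exp.2 (by nlinarith)
    _ = δ * (1 / 2) := by
        rw [Real.exp_neg, Real.exp_log (by positivity), inv_div]; ring
    _ ≤ δ * Real.log m := mul_le_mul_of_nonneg_left (h2.trans hm') hδ.le

/-- The size of a ball in the Hamming metric where coordinate `i` has weight `log (s i)`. -/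
theorem card_hamming_ball_le (hs : ∀ i, 2 ≤ s i) {δ : ℝ} (hδ : 0 < δ) (hδ1 : δ ≤ 1)
    (x : ∀ i, Fin (s i)) :
    ((Finset.univ.filter fun z : ∀ i, Fin (s i) => ∑ i, (if z i = x i then 0 else Real.log (s i)) ≤
        2 * δ * Real.log ((∏ i, s i : ℕ) : ℝ)).card : ℝ) ≤
      ((∏ i, s i : ℕ) : ℝ) ^ (δ * (3 + 4 * Real.log (2 / δ))) := by
  have hn : (0 : ℝ) < ((∏ i, s i : ℕ) : ℝ) := by
    exact_mod_cast Finset.prod_pos fun i _ => by have := hs i; omega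
  -- The Markov parameter: the `1` cancels the number `s i` of values of a coordinate, and the rest
  -- makes what remains at most `δ * log (s i)`.
  set l := 1 + 2 * Real.log (2 / δ) with hl
  have hL : 0 ≤ Real.log (2 / δ) := Real.log_nonneg (by rw [le_div_iff₀ hδ]; linarith)
  set n : ℝ := ((∏ i, s i : ℕ) : ℝ) with hndef
  have h1 := card_filter_le_exp_mul_prod
    (fun i (a : Fin (s i)) => if a = x i then 0 else -(l * Real.log (s i)))
    (-(l * (2 * δ * Real.log n)))
  have hsub : (Finset.univ.filter fun z : ∀ i, Fin (s i) =>
      ∑ i, (if z i = x i then 0 else Real.log (s i)) ≤ 2 * δ * Real.log n) ⊆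
      Finset.univ.filter fun z : ∀ i, Fin (s i) => -(l * (2 * δ * Real.log n)) ≤
        ∑ i, (if z i = x i then 0 else -(l * Real.log (s i))) := by
    intro z hz
    rw [Finset.mem_filter] at hz ⊢
    refine ⟨hz.1, ?_⟩
    have : ∑ i, (if z i = x i then 0 else -(l * Real.log (s i))) =
        -(l * ∑ i, (if z i = x i then 0 else Real.log (s i))) := by
      rw [Finset.mul_sum, ← Finset.sum_neg_distrib]
      exact Finset.sum_congr rfl fun i _ => by split_ifs <;> simp
    rw [this, neg_le_neg_iff]
    exact mul_le_mul_of_nonneg_left hz.2 (by positivity)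
  have hfac : ∀ i, ∑ a : Fin (s i), Real.exp (if a = x i then 0 else -(l * Real.log (s i))) ≤
      Real.exp (δ * Real.log (s i)) := by
    intro i
    have hsi : (0 : ℝ) < s i := by have := hs i; positivity
    calc ∑ a : Fin (s i), Real.exp (if a = x i then 0 else -(l * Real.log (s i)))
        ≤ ∑ a : Fin (s i), ((if a = x i then 1 else 0) + Real.exp (-(l * Real.log (s i)))) := by
          refine Finset.sum_le_sum fun a _ => ?_
          split_ifs
          · rw [Real.exp_zero]; linarith [Real.exp_pos (-(l * Real.log (s i)))]
          · rw [zero_add]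
      _ = 1 + Real.exp (Real.log (s i)) * Real.exp (-(l * Real.log (s i))) := by
          rw [Finset.sum_add_distrib, Real.exp_log hsi]; simp
      _ = Real.exp (-(2 * Real.log (2 / δ)) * Real.log (s i)) + 1 := by
          rw [← Real.exp_add, add_comm, hl]; congr 2; ring
      _ ≤ δ * Real.log (s i) + 1 := by linarith [exp_neg_mul_log_le (hs i) hδ hδ1]
      _ ≤ _ := Real.add_one_le_exp _
  calc _ ≤ _ := Nat.cast_le.2 (Finset.card_le_card hsub)
    _ ≤ _ := h1
    _ ≤ Real.exp (l * (2 * δ * Real.log n)) * ∏ i, Real.exp (δ * Real.log (s i)) := by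
        rw [neg_neg]
        exact mul_le_mul_of_nonneg_left (Finset.prod_le_prod
          (fun i _ => Finset.sum_nonneg fun a _ => (Real.exp_pos _).le) fun i _ => hfac i)
          (Real.exp_pos _).le
    _ = _ := by
        rw [← Real.exp_sum, ← Finset.mul_sum, ← log_prod_natCast hs, ← Real.exp_add,
          Real.rpow_def_of_pos hn, hl]
        congr 1
        ring

/-- From `exp t ≤ 1 + t + t ^ 2` for `|t| ≤ 1`: the linear terms sum to zero, and the variance of
the indicator is at most `1 / m`. -/
theorem sum_exp_indicator_sub_mean_le {m : ℕ} (a : Fin m) {u : ℝ} (hu : |u| ≤ 1) :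
    ∑ x : Fin m, Real.exp (u * ((if x = a then 1 else 0) - 1 / m)) ≤
      m * Real.exp (u ^ 2 / m) := by
  have hm : (0 : ℝ) < m := by exact_mod_cast a.pos
  have hm1 : (1 : ℝ) ≤ m := by exact_mod_cast a.pos
  have hinv : (1 : ℝ) / m ≤ 1 := (div_le_one hm).2 hm1
  have hinv0 : (0 : ℝ) < 1 / m := by positivity
  have hexp : ∀ t : ℝ, |t| ≤ 1 → Real.exp t ≤ 1 + t + t ^ 2 := fun t ht => by
    have := (abs_le.1 (Real.abs_exp_sub_one_sub_id_le ht)).2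
    linarith
  calc ∑ x : Fin m, Real.exp (u * ((if x = a then 1 else 0) - 1 / m))
      ≤ ∑ x : Fin m, (1 - u / m + u ^ 2 / m ^ 2 +
          (if x = a then u + u ^ 2 * (1 - 2 / m) else 0)) := by
        refine Finset.sum_le_sum fun x _ => (hexp _ ?_).trans (le_of_eq ?_)
        · rw [abs_mul]
          refine mul_le_one₀ hu (abs_nonneg _) ?_
          split_ifs <;> rw [abs_le] <;> constructor <;> linarith
        · split_ifs <;> field_simp <;> ring
    _ = m + u ^ 2 - u ^ 2 / m := by
        rw [Finset.sum_add_distrib]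
        simp
        field_simp
        ring
    _ ≤ m * (u ^ 2 / m + 1) := by
        have : 0 ≤ u ^ 2 / m := by positivity
        have h2 : m * (u ^ 2 / m + 1) = m + u ^ 2 := by field_simp; ring
        linarith
    _ ≤ _ := mul_le_mul_of_nonneg_left (Real.add_one_le_exp _) hm.le

/-- The weighted deviation from its mean of the number of coordinates with `x i = a i`, where `i`
ranges over the coordinates with `j < s i` and has weight `log (s i)`. -/
def deviation (j : ℕ) (a x : ∀ i, Fin (s i)) : ℝ :=
  ∑ i, if j < s i then Real.log (s i) * ((if x i = a i then 1 else 0) - 1 / s i) else 0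

theorem card_le_mul_deviation_le (hs : ∀ i, 2 ≤ s i) (j : ℕ) (a : ∀ i, Fin (s i)) {θ v : ℝ}
    (T : ℝ) (hv0 : 0 ≤ v) (hθ : ∀ i, j < s i → |θ| * Real.log (s i) ≤ 1)
    (hv : ∀ i, j < s i → Real.log (s i) / s i ≤ v) :
    ((Finset.univ.filter fun x : ∀ i, Fin (s i) => T ≤ θ * deviation j a x).card : ℝ) ≤
      ((∏ i, s i : ℕ) : ℝ) * Real.exp (-T + θ ^ 2 * v * Real.log ((∏ i, s i : ℕ) : ℝ)) := by
  have h1 := card_filter_le_exp_mul_prod (fun i (b : Fin (s i)) =>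
    θ * if j < s i then Real.log (s i) * ((if b = a i then 1 else 0) - 1 / s i) else 0) T
  simp_rw [← Finset.mul_sum] at h1
  refine h1.trans ?_
  have hfac : ∀ i, ∑ b : Fin (s i), Real.exp (θ *
      if j < s i then Real.log (s i) * ((if b = a i then 1 else 0) - 1 / s i) else 0) ≤
      s i * Real.exp (θ ^ 2 * v * Real.log (s i)) := by
    intro i
    have hsi : (1 : ℝ) ≤ s i := by exact_mod_cast (by have := hs i; omega : 1 ≤ s i)
    have hlog : 0 ≤ Real.log (s i) := Real.log_nonneg hsi
    by_cases hj : j < s i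
    · simp only [hj, if_true, ← mul_assoc]
      refine (sum_exp_indicator_sub_mean_le (a i) ?_).trans ?_
      · rw [abs_mul, abs_of_nonneg hlog]; exact hθ i hj
      · refine mul_le_mul_of_nonneg_left (Real.exp_le_exp.2 ?_) (by linarith)
        have := mul_le_mul_of_nonneg_left (hv i hj) (mul_nonneg (sq_nonneg θ) hlog)
        calc (θ * Real.log (s i)) ^ 2 / s i
            = θ ^ 2 * Real.log (s i) * (Real.log (s i) / s i) := by ring
          _ ≤ _ := by linarith
    · simp only [hj, if_false, mul_zero, Real.exp_zero, Finset.sum_const, Finset.card_univ,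
        Fintype.card_fin, nsmul_eq_mul]
      exact mul_le_mul_of_nonneg_left (Real.one_le_exp (by positivity)) (by linarith)
  refine (mul_le_mul_of_nonneg_left (Finset.prod_le_prod
    (fun i _ => Finset.sum_nonneg fun b _ => (Real.exp_pos _).le) fun i _ => hfac i)
    (Real.exp_pos _).le).trans (le_of_eq ?_)
  rw [Finset.prod_mul_distrib, ← Real.exp_sum, ← Finset.mul_sum, ← log_prod_natCast hs,
    Real.exp_add, Nat.cast_prod]
  ring

end Counting

/-! ### One Kronecker product of arrows -/

/-- The Kronecker product of matrices, each supported on the diagonal and at most one column, is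
close in rank to a sparse matrix. -/
theorem isLowRankAddSparse_kroneckerProd_arrow {F : Type*} [Field F] {k : ℕ} {s : Fin k → ℕ}
    (hs : ∀ i, 2 ≤ s i) (A : ∀ i, Matrix (Fin (s i)) (Fin (s i)) F) (j : ℕ) (a : ∀ i, Fin (s i))
    (hA : ∀ i x y, A i x y ≠ 0 → x = y ∨ (j < s i ∧ y = a i)) {δ v : ℝ} (hδ : 0 < δ)
    (hδ1 : δ ≤ 1) (hv0 : 0 < v) (hθ : ∀ i, j < s i → δ / (2 * v) * Real.log (s i) ≤ 1)
    (hv : ∀ i, j < s i → Real.log (s i) / s i ≤ v) :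
    IsLowRankAddSparse (kroneckerProd A) (2 * ((∏ i, s i : ℕ) : ℝ) ^ (1 - δ ^ 2 / (4 * v)))
      (((∏ i, s i : ℕ) : ℝ) ^ (δ * (3 + 4 * Real.log (2 / δ)))) := by
  classical
  have hn : (0 : ℝ) < ((∏ i, s i : ℕ) : ℝ) := by
    exact_mod_cast Finset.prod_pos fun i _ => by have := hs i; omega
  have hball := card_hamming_ball_le hs hδ hδ1
  have htail := fun θ T (hθ' : |θ| = δ / (2 * v)) =>
    card_le_mul_deviation_le hs j a (θ := θ) T hv0.le (fun i hi => by rw [hθ']; exact hθ i hi) hv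
  set n : ℝ := ((∏ i, s i : ℕ) : ℝ) with hndef
  have hθ0 : 0 < δ / (2 * v) := by positivity
  set R := Finset.univ.filter fun x : ∀ i, Fin (s i) =>
    δ / (2 * v) * (δ * Real.log n) ≤ -(δ / (2 * v)) * deviation j a x with hR
  set C := Finset.univ.filter fun x : ∀ i, Fin (s i) =>
    δ / (2 * v) * (δ * Real.log n) ≤ δ / (2 * v) * deviation j a x with hC
  -- `|θ| = δ / (2 * v)` minimizes `-|θ| * δ + θ ^ 2 * v`, with minimum `-δ ^ 2 / (4 * v)`.
  have hexp : ∀ θ : ℝ, θ ^ 2 = (δ / (2 * v)) ^ 2 →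
      n * Real.exp (-(δ / (2 * v) * (δ * Real.log n)) + θ ^ 2 * v * Real.log n) =
        n ^ (1 - δ ^ 2 / (4 * v)) := by
    intro θ h
    rw [h, Real.rpow_def_of_pos hn]
    nth_rewrite 1 [← Real.exp_log hn]
    rw [← Real.exp_add]
    congr 1
    field_simp
    ring
  have hRc : (R.card : ℝ) ≤ n ^ (1 - δ ^ 2 / (4 * v)) :=
    (htail _ _ (by rw [abs_neg, abs_of_pos hθ0])).trans_eq (hexp _ (by ring))
  have hCc : (C.card : ℝ) ≤ n ^ (1 - δ ^ 2 / (4 * v)) :=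
    (htail _ _ (abs_of_pos hθ0)).trans_eq (hexp _ rfl)
  have hdist : ∀ x y, x ∉ R → y ∉ C → kroneckerProd A x y ≠ 0 →
      ∑ i, (if y i = x i then 0 else Real.log (s i)) ≤ 2 * δ * Real.log n := by
    intro x y hx hy hxy
    have h1 : -(δ * Real.log n) < deviation j a x := by
      simp only [hR, Finset.mem_filter, Finset.mem_univ, true_and, not_le, neg_mul] at hx
      rw [← mul_neg] at hx
      linarith [lt_of_mul_lt_mul_left hx hθ0.le]
    have h2 : deviation j a y < δ * Real.log n := by
      simp only [hC, Finset.mem_filter, Finset.mem_univ, true_and, not_le] at hy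
      exact lt_of_mul_lt_mul_left hy hθ0.le
    -- Where `x i ≠ y i`, the column agrees with `a` and the row does not. The means cancel, so the
    -- difference of deviations is exactly the weighted distance.
    have h3 : ∑ i, (if y i = x i then 0 else Real.log (s i)) =
        deviation j a y - deviation j a x := by
      rw [deviation, deviation, ← Finset.sum_sub_distrib]
      refine Finset.sum_congr rfl fun i _ => ?_
      have hi : A i (x i) (y i) ≠ 0 := by
        simp only [kroneckerProd, Matrix.of_apply] at hxy
        exact Finset.prod_ne_zero_iff.1 hxy i (Finset.mem_univ i)
      by_cases hxi : y i = x i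
      · simp [hxi]
      · obtain ⟨hj, hya⟩ := (hA i _ _ hi).resolve_left fun h => hxi h.symm
        have hxa : x i ≠ a i := fun h => hxi (hya.trans h.symm)
        simp only [hj, hya, hxa, if_true, if_false]
        rw [if_neg (fun h => hxa h.symm)]
        ring
    linarith
  refine (isLowRankAddSparse_of_delete R C (fun x => ?_) fun y => ?_).mono
    (by linarith) le_rfl
  · refine le_trans ?_ (hball x)
    rw [← Set.ncard_coe_finset]
    refine Nat.cast_le.2 (Set.ncard_le_ncard (fun y hy => ?_) (Set.toFinite _))
    simpa using hdist x y hy.1 hy.2.1 hy.2.2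
  · refine le_trans ?_ (hball y)
    rw [← Set.ncard_coe_finset]
    refine Nat.cast_le.2 (Set.ncard_le_ncard (fun x hx => ?_) (Set.toFinite _))
    simpa [eq_comm] using hdist x y hx.1 hx.2.1 hx.2.2

/-! ### Multiplying the arrow products together -/

theorem sum_inv_sqrt_le (N : ℕ) :
    ∑ j ∈ Finset.range N, 1 / √((j : ℝ) + 1) ≤ 2 * √(N : ℝ) := by
  induction N with
  | zero => simp
  | succ N ih =>
    rw [Finset.sum_range_succ, Nat.cast_add, Nat.cast_one]
    have h0 : (0 : ℝ) ≤ N := Nat.cast_nonneg N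
    have h1 : 0 < √((N : ℝ) + 1) := Real.sqrt_pos.2 (by linarith)
    have h2 := Real.sq_sqrt h0
    have h3 := Real.sq_sqrt (show (0 : ℝ) ≤ N + 1 by linarith)
    have h4 : 1 / √((N : ℝ) + 1) ≤ 2 * (√((N : ℝ) + 1) - √(N : ℝ)) := by
      rw [div_le_iff₀ h1]
      nlinarith [sq_nonneg (√((N : ℝ) + 1) - √(N : ℝ))]
    linarith

/-- The trade-off between rank and sparsity for Kronecker products of matrices of size at most `d`,
in terms of a parameter `η`. -/
theorem isLowRankAddSparse_kroneckerProd {F : Type*} [Field F] {k d : ℕ} {s : Fin k → ℕ}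
    (hd : 2 ≤ d) (hs : ∀ i, 2 ≤ s i ∧ s i ≤ d) (M : ∀ i, Matrix (Fin (s i)) (Fin (s i)) F)
    {η : ℝ} (hη : 0 < η) (hη1 : η ≤ 1) :
    IsLowRankAddSparse (kroneckerProd M)
      (2 * d * ((∏ i, s i : ℕ) : ℝ) ^ (1 - η ^ 2 / (4 * d * Real.log d)))
      (((∏ i, s i : ℕ) : ℝ) ^ (2 * η * (3 + 4 * Real.log (2 * d / η)))) := by
  have hs2 : ∀ i, 2 ≤ s i := fun i => (hs i).1
  have hn1 : (1 : ℝ) ≤ ((∏ i, s i : ℕ) : ℝ) := by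
    exact Nat.one_le_cast.2
      (Nat.one_le_iff_ne_zero.2 <| Finset.prod_ne_zero_iff.2 fun i _ => by have := hs2 i; omega)
  have hd' : (2 : ℝ) ≤ d := by exact_mod_cast hd
  have hlogd : 0 < Real.log d := Real.log_pos (by linarith)
  choose P p C a hp hP hC hM using fun i => exists_mul_prod_arrow
    (by have := hs2 i; omega) (hs i).2 (M i)
  have hMeq : kroneckerProd M = kroneckerProd P *
      ((List.range d).map fun j => kroneckerProd fun i => C i j).prod := by
    rw [← kroneckerProd_prod_range, ← kroneckerProd_mul]
    exact congrArg _ (funext hM)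
  have hPsp : IsLowRankAddSparse (kroneckerProd P) 0 1 := by
    refine isLowRankAddSparse_of_injective (p := fun y i => p i (y i))
      (fun x y h => funext fun i => hp i (congrFun h i)) fun x y h => funext fun i => hP i _ _ ?_
    simp only [kroneckerProd, Matrix.of_apply] at h
    exact Finset.prod_ne_zero_iff.1 h i (Finset.mem_univ i)
  set n : ℝ := ((∏ i, s i : ℕ) : ℝ) with hn
  -- With `v = log d / (j + 1)`, this makes `δ j ^ 2 / (4 * v)` independent of `j`, while the `δ j`
  -- sum to at most `2 * η`.
  set δ : ℕ → ℝ := fun j => η / √(d * ((j : ℝ) + 1)) with hδ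
  have hδ0 : ∀ j, 0 < δ j := fun j => by positivity
  have hsq : ∀ j < d, (j : ℝ) + 1 ≤ √(d * ((j : ℝ) + 1)) ∧ √(d * ((j : ℝ) + 1)) ≤ d := by
    intro j hj
    have hjd : (j : ℝ) + 1 ≤ d := by exact_mod_cast hj
    have hj0 : (0 : ℝ) < (j : ℝ) + 1 := by positivity
    exact ⟨Real.le_sqrt_of_sq_le (by nlinarith), Real.sqrt_le_iff.2 ⟨by linarith, by nlinarith⟩⟩
  have hfac : ∀ j < d, IsLowRankAddSparse (kroneckerProd fun i => C i j)
      (2 * n ^ (1 - η ^ 2 / (4 * d * Real.log d)))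
      (n ^ (δ j * (3 + 4 * Real.log (2 / δ j)))) := by
    intro j hj
    have hj0 : (0 : ℝ) < (j : ℝ) + 1 := by positivity
    have hsq0 : 0 < √(d * ((j : ℝ) + 1)) := by positivity
    have hδj : δ j * ((j : ℝ) + 1) ≤ 1 := by
      rw [hδ, div_mul_eq_mul_div, div_le_one hsq0]
      nlinarith [(hsq j hj).1]
    have hlogs : ∀ i, Real.log (s i) ≤ Real.log d := fun i =>
      Real.log_le_log (by have := hs2 i; positivity) (by exact_mod_cast (hs i).2)
    have h := isLowRankAddSparse_kroneckerProd_arrow hs2 (fun i => C i j) j (fun i => a i j)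
      (fun i => hC i j) (δ := δ j) (v := Real.log d / (j + 1)) (hδ0 j)
      (by nlinarith [hδ0 j, (Nat.cast_nonneg j : (0 : ℝ) ≤ j)]) (by positivity)
      (fun i _ => by
        calc δ j / (2 * (Real.log d / (j + 1))) * Real.log (s i)
            ≤ δ j / (2 * (Real.log d / (j + 1))) * Real.log d :=
              mul_le_mul_of_nonneg_left (hlogs i) (by have := hδ0 j; positivity)
          _ = δ j * (j + 1) / 2 := by field_simp
          _ ≤ 1 := by linarith)
      (fun i hi => div_le_div₀ hlogd.le (hlogs i) hj0 (by exact_mod_cast hi))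
    have hexp : δ j ^ 2 / (4 * (Real.log d / (j + 1))) = η ^ 2 / (4 * d * Real.log d) := by
      rw [hδ, div_pow, Real.sq_sqrt (by positivity)]
      field_simp
    rwa [hexp] at h
  have hall := hPsp.mul_prod_range _ _ _ d hfac
  rw [← hMeq, zero_add, one_mul, Finset.sum_const, Finset.card_range, nsmul_eq_mul, ← mul_assoc,
    mul_comm (d : ℝ) 2, ← Real.rpow_sum_of_pos (by linarith)] at hall
  refine hall.mono le_rfl (Real.rpow_le_rpow_of_exponent_le hn1 ?_)
  have hK : 0 ≤ 3 + 4 * Real.log (2 * d / η) := by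
    have : 0 ≤ Real.log (2 * d / η) := Real.log_nonneg (by rw [le_div_iff₀ hη]; linarith)
    linarith
  have hsum : ∑ j ∈ Finset.range d, δ j ≤ 2 * η := by
    have h1 : ∀ j, δ j = η / √(d : ℝ) * (1 / √((j : ℝ) + 1)) := fun j => by
      simp only [hδ]
      rw [Real.sqrt_mul (by linarith), div_mul_div_comm, mul_one]
    simp_rw [h1]
    rw [← Finset.mul_sum]
    have hd0 : 0 < √(d : ℝ) := Real.sqrt_pos.2 (by linarith)
    calc _ ≤ η / √(d : ℝ) * (2 * √(d : ℝ)) :=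
          mul_le_mul_of_nonneg_left (sum_inv_sqrt_le d) (by positivity)
      _ = 2 * η := by field_simp
  calc ∑ j ∈ Finset.range d, δ j * (3 + 4 * Real.log (2 / δ j))
      ≤ ∑ j ∈ Finset.range d, δ j * (3 + 4 * Real.log (2 * d / η)) := by
        refine Finset.sum_le_sum fun j hj => mul_le_mul_of_nonneg_left ?_ (hδ0 j).le
        have h1 : 2 / δ j ≤ 2 * d / η := by
          simp only [hδ]
          rw [div_div_eq_mul_div]
          gcongr
          exact (hsq j (Finset.mem_range.1 hj)).2
        linarith [Real.log_le_log (by have := hδ0 j; positivity) h1]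
    _ ≤ _ := by
        rw [← Finset.sum_mul]
        exact mul_le_mul_of_nonneg_right hsum hK

/-! ### Choice of constants -/

/-- The sparsity exponent is at most `ε` for `η = ε / (200 * log (d / ε))`. -/
theorem sparsity_exponent_le {d ε : ℝ} (hd : 2 ≤ d) (hε : 0 < ε) (hε1 : ε < 1) :
    2 * (ε / (200 * Real.log (d / ε))) *
      (3 + 4 * Real.log (2 * d / (ε / (200 * Real.log (d / ε))))) ≤ ε := by
  have hL2 : Real.log 2 ≤ Real.log (d / ε) :=
    Real.log_le_log (by norm_num) (by rw [le_div_iff₀ hε]; nlinarith)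
  have h2 := Real.log_two_gt_d9
  have h2' := Real.log_two_lt_d9
  set L := Real.log (d / ε) with hL
  have hL0 : 0 < L := by linarith
  have h1 : 2 * d / (ε / (200 * L)) = 400 * L * (d / ε) := by field_simp; ring
  have h400 : Real.log 400 ≤ 9 * Real.log 2 := by
    rw [← Real.log_rpow (by norm_num)]
    exact Real.log_le_log (by norm_num) (by norm_num)
  have h3 : Real.log (2 * d / (ε / (200 * L))) ≤ 9 * Real.log 2 + 2 * L := by
    rw [h1, Real.log_mul (by positivity) (by positivity), Real.log_mul (by norm_num) hL0.ne', ← hL]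
    linarith [Real.log_le_sub_one_of_pos hL0]
  have h4 : 3 + 4 * Real.log (2 * d / (ε / (200 * L))) ≤ 100 * L := by linarith
  calc _ ≤ 2 * (ε / (200 * L)) * (100 * L) := mul_le_mul_of_nonneg_left h4 (by positivity)
    _ = ε := by field_simp; norm_num

end KroneckerRigidity
end

theorem theorem5p4 :
    ∃ c : ℝ, 0 < c ∧ ∀ (d : ℕ) (ε : ℝ), 2 ≤ d → 0 < ε → ε < 1 →
      ∃ γ : ℝ,
        c * (ε ^ 2 / ((d : ℝ) ^ (3 / 2 : ℝ) * Real.log d * Real.log (d / ε) ^ 2)) ≤ γ ∧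
        ∀ (F : Type*) [Field F] (k : ℕ) (s : Fin k → ℕ), (∀ i, 2 ≤ s i ∧ s i ≤ d) →
          ∀ (M : ∀ i, Matrix (Fin (s i)) (Fin (s i)) F) (n : ℕ), n = ∏ i, s i →
            (d : ℝ) ^ (1 / γ) ≤ (n : ℝ) →
              (KroneckerRigidity.rcRigidity (KroneckerRigidity.kroneckerProd M)
                  ((n : ℝ) ^ (1 - γ)) : ℝ) ≤ (n : ℝ) ^ ε ∧
              (KroneckerRigidity.rigidity (KroneckerRigidity.kroneckerProd M)
                  ((n : ℝ) ^ (1 - γ)) : ℝ) ≤ (n : ℝ) ^ (1 + ε) := by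
  -- `480000 = 12 * 200 ^ 2`, from `γ = η ^ 2 / (12 * d * log d)` and `η = ε / (200 * L)`.
  refine ⟨1 / 480000, by norm_num, fun d ε hd hε hε1 => ?_⟩
  have hd' : (2 : ℝ) ≤ d := by exact_mod_cast hd
  have hlogd : 0 < Real.log d := Real.log_pos (by linarith)
  have hL2 : Real.log 2 ≤ Real.log (d / ε) :=
    Real.log_le_log (by norm_num) (by rw [le_div_iff₀ hε]; nlinarith)
  have hexpo := KroneckerRigidity.sparsity_exponent_le hd' hε hε1
  set L := Real.log (d / ε) with hL
  have hL0 : 1 / 2 < L := by linarith [Real.log_two_gt_d9]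
  set η := ε / (200 * L) with hηdef
  have hη : 0 < η := by positivity
  have hη1 : η ≤ 1 := by rw [hηdef, div_le_one (by positivity)]; linarith
  set γ := η ^ 2 / (12 * d * Real.log d) with hγdef
  have hγ : 0 < γ := by positivity
  refine ⟨γ, ?_, fun F _ k s hs M n hn hdn => ?_⟩
  -- The construction gives the stronger denominator with `d`; it is weakened here to `d ^ (3 / 2)`.
  · have h32 : (d : ℝ) ≤ (d : ℝ) ^ (3 / 2 : ℝ) := by
      nth_rewrite 1 [← Real.rpow_one (d : ℝ)]
      exact Real.rpow_le_rpow_of_exponent_le (by linarith) (by norm_num)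
    have h1 : γ = 1 / 480000 * (ε ^ 2 / (d * Real.log d * L ^ 2)) := by
      rw [hγdef, hηdef]; field_simp; norm_num
    rw [h1]
    gcongr
  · have hmain := KroneckerRigidity.isLowRankAddSparse_kroneckerProd hd hs M hη hη1
    rw [← hn] at hmain
    have hn0 : (1 : ℝ) ≤ n := by
      rw [hn]
      exact Nat.one_le_cast.2
        (Nat.one_le_iff_ne_zero.2 <| Finset.prod_ne_zero_iff.2 fun i _ => by
          have := (hs i).1; omega)
    have hdγ : (d : ℝ) ≤ (n : ℝ) ^ γ := by
      have := Real.rpow_le_rpow (by positivity) hdn hγ.le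
      rwa [← Real.rpow_mul (by positivity), one_div, inv_mul_cancel₀ hγ.ne', Real.rpow_one] at this
    -- The saving in the exponent is `3 * γ`. Two of the three `γ` are spent on the factors `2` and
    -- `d`, each at most `n ^ γ`.
    have hrank : 2 * d * (n : ℝ) ^ (1 - η ^ 2 / (4 * d * Real.log d)) ≤ (n : ℝ) ^ (1 - γ) := by
      have h1 : η ^ 2 / (4 * d * Real.log d) = 3 * γ := by rw [hγdef]; field_simp; norm_num
      have h2 : (n : ℝ) ^ (1 - γ) = (n : ℝ) ^ γ * (n : ℝ) ^ γ * (n : ℝ) ^ (1 - 3 * γ) := by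
        rw [← Real.rpow_add (by linarith), ← Real.rpow_add (by linarith)]
        congr 1
        ring
      rw [h1, h2]
      exact mul_le_mul_of_nonneg_right (mul_le_mul (by linarith) hdγ (by positivity) (by positivity))
        (by positivity)
    have hfin := hmain.mono hrank (Real.rpow_le_rpow_of_exponent_le hn0 hexpo)
    refine ⟨hfin.rcRigidity_le (by positivity), hfin.rigidity_le.trans_eq ?_⟩
    rw [Real.rpow_add (by linarith), Real.rpow_one, hn]
    simp
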